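/- Let $K$ be a field, $A=K[x_1,\dots,x_n]$ and $\mathfrak m=(x_1,\dots,x_n)$. For a monomial ideal $J\subset A$ let $G(J)$ be its unique minimal set of monomial generators and let $\operatorname{conv}(J)\subset\mathbb R^n$ be the convex hull of $\{a\in\mathbb N^n : x^a\in J\}$. A face of $\operatorname{conv}(J)$ is the empty set, $\operatorname{conv}(J)$ itself, or the intersection of $\operatorname{conv}(J)$ with a supporting hyperplane. Let $\mathcal F_{mc}$ be the set of those compact faces of $\operatorname{conv}(J)$ that are maximal, with respect to inclusion, among all compact faces. Assume that $J$ is an extremal ideal, that is, a monomial ideal such that the exponent vectors of the elements of $G(J)$ are exactly the extreme points of $\operatorname{conv}(J)$. Write $G(J)=\{f_1,\dots,f_r\}$ with $f_j=x^{a_j}$ pairwise distinct, let $\mathcal R(J)=\bigoplus_{m\ge 0}J^mt^m\subset A[t]$ be the Rees algebra, let $\mathcal F(J)=\mathcal R(J)/\mathfrak m\mathcal R(J)$ be the fiber ring, and let $D$ be the kernel of the $K$-algebra epimorphism $\psi:T=K[y_1,\dots,y_r]\to\mathcal F(J)$ that sends $y_j$ to the class of $f_jt$, so that $\mathcal F(J)\cong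 T/D$. For $F\in\mathcal F_{mc}$ let $P_F\subset T$ be the ideal generated by the variables $y_j$ with $a_j\notin F$, and let $B_F$ be the kernel of the $K$-algebra homomorphism $K[y_j : a_j\in F]\to K[F]:=K[f_jt : a_j\in F]\subset A[t]$, $y_j\mapsto f_jt$. Then, where each $B_F$ stands for the ideal of $T$ that it generates, $$\sqrt D=\bigcap_{F\in\mathcal F_{mc}}P_F+\sum_{F\in\mathcal F_{mc}}B_F=\bigcap_{F\in\mathcal F_{mc}}\left(P_F+B_F\right).$$ -/

import Mathlib

namespace ExtremalIdeal

open MvPolynomial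

/-- The hyperplane `{v | ⟨v, u⟩ = c}` is a supporting hyperplane of `X ⊆ ℝⁿ`: its normal `u` is
nonzero, `X` lies in `{v | ⟨v, u⟩ ≥ c}`, and `X` meets the hyperplane. -/
def IsSupportingHyperplane {n : ℕ} (X : Set (Fin n → ℝ)) (u : Fin n → ℝ) (c : ℝ) : Prop :=
  u ≠ 0 ∧ (∀ v ∈ X, c ≤ v ⬝ᵥ u) ∧ ∃ v ∈ X, v ⬝ᵥ u = c

/-- `F` is a face of `X ⊆ ℝⁿ`: `F` is empty, or `F = X`, or `F` is the intersection of `X` with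
a supporting hyperplane of `X`. -/
def IsFace {n : ℕ} (X F : Set (Fin n → ℝ)) : Prop :=
  F = ∅ ∨ F = X ∨
    ∃ (u : Fin n → ℝ) (c : ℝ), IsSupportingHyperplane X u c ∧ F = {v ∈ X | v ⬝ᵥ u = c}

/-- The maximal compact faces of `X`: the maximal elements, with respect to inclusion, of the set
of compact faces of `X`. -/
def maximalCompactFaces {n : ℕ} (X : Set (Fin n → ℝ)) : Set (Set (Fin n → ℝ)) :=
  {F | Maximal (fun G => IsFace X G ∧ IsCompact G) F}

/-- An exponent vector, seen as a point of `ℝⁿ`. -/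
def toPoint {n : ℕ} (a : Fin n →₀ ℕ) : Fin n → ℝ := fun i => (a i : ℝ)

variable {K : Type*} [Field K] {n : ℕ}

/-- `J` is a monomial ideal of `K[x₁, …, xₙ]`: it is generated by a set of monomials. -/
def IsMonomialIdeal (J : Ideal (MvPolynomial (Fin n) K)) : Prop :=
  ∃ S : Set (Fin n →₀ ℕ), J = Ideal.span ((fun a => monomial a (1 : K)) '' S)

/-- `Γ(J) = {a | xᵃ ∈ J}`. -/
def exponents (J : Ideal (MvPolynomial (Fin n) K)) : Set (Fin n →₀ ℕ) :=
  {a | monomial a (1 : K) ∈ J}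

/-- `Γ(G(J))`: the exponents of the minimal monomial generators of a monomial ideal `J`, that is,
of the monomials of `J` that are minimal with respect to divisibility. -/
def minGenExponents (J : Ideal (MvPolynomial (Fin n) K)) : Set (Fin n →₀ ℕ) :=
  {a | Minimal (fun b => b ∈ exponents J) a}

/-- `conv(J)`, the convex hull in `ℝⁿ` of `Γ(J)` (the Newton polyhedron of `J`). -/
def newtonPolyhedron (J : Ideal (MvPolynomial (Fin n) K)) : Set (Fin n → ℝ) :=
  convexHull ℝ (toPoint '' exponents J)

/-- `J` is an extremal ideal: it is a monomial ideal, and the exponents of its minimal monomial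
generators are exactly the extreme points of `conv(J)`. -/
def IsExtremal (J : Ideal (MvPolynomial (Fin n) K)) : Prop :=
  IsMonomialIdeal J ∧ toPoint '' minGenExponents J = (newtonPolyhedron J).extremePoints ℝ

/-- The fiber ring `F(J) = R(J) / 𝔪 R(J)`, where `R(J)` is the Rees algebra of `J` and
`𝔪 = (x₁, …, xₙ)`. -/
abbrev FiberRing (J : Ideal (MvPolynomial (Fin n) K)) : Type _ :=
  reesAlgebra J ⧸ (Ideal.span (Set.range (X : Fin n → MvPolynomial (Fin n) K))).map
    (algebraMap (MvPolynomial (Fin n) K) (reesAlgebra J))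

/-- The element `xᵃ t` of `A[t]`, where `A = K[x₁, …, xₙ]`. -/
noncomputable def monomialT (K : Type*) [Field K] {n : ℕ} (a : Fin n →₀ ℕ) :
    Polynomial (MvPolynomial (Fin n) K) :=
  Polynomial.monomial 1 (monomial a (1 : K))

/-- If `xᵃ ∈ J` then `xᵃ t` belongs to the Rees algebra of `J`. -/
theorem monomialT_mem_reesAlgebra {J : Ideal (MvPolynomial (Fin n) K)} {a : Fin n →₀ ℕ}
    (ha : a ∈ exponents J) : monomialT K a ∈ reesAlgebra J :=
  reesAlgebra.monomial_mem.2 (by rw [pow_one]; exact ha)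

/-- The epimorphism `ψ : K[y₁, …, yᵣ] → F(J)` sending `y_j` to the class of `f_j t`, where
`f_j = x^{a_j}` and `a₁, …, aᵣ` is an enumeration without repetition of `Γ(G(J))`. -/
noncomputable def fiberMap {r : ℕ} (J : Ideal (MvPolynomial (Fin n) K))
    (a : Fin r ≃ minGenExponents J) : MvPolynomial (Fin r) K →ₐ[K] FiberRing J :=
  aeval fun j => Ideal.Quotient.mk _
    (⟨monomialT K (a j : Fin n →₀ ℕ), monomialT_mem_reesAlgebra (a j).2.1⟩ : reesAlgebra J)

/-- The defining ideal `D = ker ψ` of the fiber ring: `F(J) = K[y₁, …, yᵣ] / D`. -/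
noncomputable def fiberIdeal {r : ℕ} (J : Ideal (MvPolynomial (Fin n) K))
    (a : Fin r ≃ minGenExponents J) : Ideal (MvPolynomial (Fin r) K) :=
  RingHom.ker (fiberMap J a)

/-- `P_F = (y_j : a_j ∉ F)`. -/
noncomputable def idealP (K : Type*) [Field K] {n r : ℕ} (a : Fin r → Fin n →₀ ℕ)
    (F : Set (Fin n → ℝ)) : Ideal (MvPolynomial (Fin r) K) :=
  Ideal.span (X '' {j | toPoint (a j) ∉ F})

/-- The toric ring `K[F] = K[f_j t : a_j ∈ F] ⊆ A[t]`. -/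
noncomputable def toricRing (K : Type*) [Field K] {n r : ℕ} (a : Fin r → Fin n →₀ ℕ)
    (F : Set (Fin n → ℝ)) : Subalgebra K (Polynomial (MvPolynomial (Fin n) K)) :=
  Algebra.adjoin K ((fun j => monomialT K (a j)) '' {j | toPoint (a j) ∈ F})

/-- `θ_F : K[y_j : a_j ∈ F] → K[F]`, `y_j ↦ f_j t`. -/
noncomputable def toricMap (K : Type*) [Field K] {n r : ℕ} (a : Fin r → Fin n →₀ ℕ)
    (F : Set (Fin n → ℝ)) :
    MvPolynomial {j : Fin r // toPoint (a j) ∈ F} K →ₐ[K] toricRing K a F :=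
  aeval fun j => ⟨monomialT K (a j), Algebra.subset_adjoin ⟨j, j.2, rfl⟩⟩

/-- The ideal of `K[y₁, …, yᵣ]` generated by the toric ideal `B_F = ker θ_F` of
`K[y_j : a_j ∈ F] ⊆ K[y₁, …, yᵣ]`. -/
noncomputable def idealB (K : Type*) [Field K] {n r : ℕ} (a : Fin r → Fin n →₀ ℕ)
    (F : Set (Fin n → ℝ)) : Ideal (MvPolynomial (Fin r) K) :=
  (RingHom.ker (toricMap K a F)).map
    (rename (Subtype.val : {j : Fin r // toPoint (a j) ∈ F} → Fin r) :
      MvPolynomial {j : Fin r // toPoint (a j) ∈ F} K →ₐ[K] MvPolynomial (Fin r) K)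

end ExtremalIdeal

namespace ExtremalIdeal

open MvPolynomial

/-! ### Farkas' lemma and a dichotomy for Newton polyhedra -/

section Farkas

variable {𝕜 V : Type*} [Field 𝕜] [LinearOrder 𝕜] [IsStrictOrderedRing 𝕜] [AddCommGroup V]
  [Module 𝕜 V]

/-! The argument uses the grading of `A[t]` by pairs (b, m), the degree of x^b t^m. Let u have
positive entries and let c be a lower bound for ⟨·, u⟩ on conv(J). The excess ⟨b, u⟩ - c m is
additive, is ≥ 0 on the support of the Rees algebra, and is > 0 on the support of 𝔪R(J), because x_i
adds u_i > 0. On a product of the f_j t it vanishes exactly when every factor lies on the face cut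
out by (u, c). The compact faces are precisely the faces given by such u
(`isFace_and_isCompact_iff`).

Sending y_j to f_j t for a_j ∈ F and to 0 otherwise therefore kills D (`fiberIdeal_le_ker_faceMap`).
Its kernel is P_F + B_F (`ker_faceMap`), which is prime, so √D ⊆ ⋂(P_F + B_F). The excess depends
only on the degree, so the monomials in one graded piece of T are either all supported on F or none
of them is. This gives ⋂(P_F + B_F) ⊆ ⋂P_F + ∑B_F (`iInf_sup_le`).

The cycle closes because B_F ⊆ D, the relations among the f_j t already holding in R(J), and because
⋂P_F ⊆ √D. For the latter, take y^α of degree (b, m) supported on no compact face. Farkas' lemma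
over ℚ (`exists_pos_functional_or`) yields S and i with x^{Sb} ∈ x_i J^{Sm}, so a power of y^α lies
in D. -/

theorem farkas_fin {m : ℕ} (A : Fin m → Module.Dual 𝕜 V) (b : Module.Dual 𝕜 V)
    (h : ∀ x, (∀ i, 0 ≤ A i x) → 0 ≤ b x) :
    ∃ l : Fin m → 𝕜, (∀ i, 0 ≤ l i) ∧ b = ∑ i, l i • A i := by
  induction m generalizing b with
  | zero =>
    refine ⟨fun _ => 0, fun i => i.elim0, ?_⟩
    ext x
    have h1 := h x fun i => i.elim0
    have h2 := h (-x) fun i => i.elim0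
    simp only [map_neg] at h2
    simp only [Finset.univ_eq_empty, Finset.sum_empty, LinearMap.zero_apply]
    linarith
  | succ m ih =>
    by_cases hb : ∀ x, (∀ i : Fin m, 0 ≤ A i.castSucc x) → 0 ≤ b x
    · obtain ⟨l, hl, he⟩ := ih (fun i => A i.castSucc) b hb
      refine ⟨Fin.snoc l 0, fun i => ?_, ?_⟩
      · refine Fin.lastCases ?_ (fun i => ?_) i
        · simp
        · simpa using hl i
      · rw [Fin.sum_univ_castSucc]
        simpa using he
    · push Not at hb
      obtain ⟨y, hy, hby⟩ := hb
      have hlast : A (Fin.last m) y < 0 := by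
        by_contra! hc
        exact absurd (h y fun i => Fin.lastCases hc hy i) (not_le.2 hby)
      obtain ⟨z, hz, hbz, hAz⟩ : ∃ z, (∀ i : Fin m, 0 ≤ A i.castSucc z) ∧ b z < 0 ∧
          A (Fin.last m) z = -1 := by
        have hp : 0 < (-(A (Fin.last m) y))⁻¹ := inv_pos.2 (by linarith)
        refine ⟨(-(A (Fin.last m) y))⁻¹ • y, fun i => ?_, ?_, ?_⟩
        · rw [map_smul, smul_eq_mul]
          exact mul_nonneg hp.le (hy i)
        · rw [map_smul, smul_eq_mul]
          exact mul_neg_of_pos_of_neg hp hby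
        · rw [map_smul, smul_eq_mul]
          field_simp [hlast.ne]
      -- The map x ↦ x + A_last(x) z is the projection along z onto the kernel of A_last. The
      -- induction hypothesis is applied to the other functionals composed with it. Expanding gives
      -- the last coefficient ∑ l_i A_i(z) - b(z), nonnegative since A_i(z) ≥ 0 and b(z) < 0.
      obtain ⟨l, hl, he⟩ := ih (fun i => A i.castSucc + A i.castSucc z • A (Fin.last m))
        (b + b z • A (Fin.last m)) (fun x hx => by
          have := h (x + A (Fin.last m) x • z) (fun i => by
            refine Fin.lastCases ?_ (fun i => ?_) i
            · simp [hAz]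
            · have := hx i
              simp only [LinearMap.add_apply, LinearMap.smul_apply, smul_eq_mul] at this
              simp only [map_add, map_smul, smul_eq_mul]
              linarith [mul_comm (A i.castSucc z) (A (Fin.last m) x)])
          simp only [map_add, map_smul, smul_eq_mul] at this
          simp only [LinearMap.add_apply, LinearMap.smul_apply, smul_eq_mul]
          linarith [mul_comm (b z) (A (Fin.last m) x)])
      refine ⟨Fin.snoc l ((∑ i, l i * A i.castSucc z) - b z), fun i => ?_, ?_⟩
      · refine Fin.lastCases ?_ (fun i => ?_) i
        · have : 0 ≤ ∑ i, l i * A i.castSucc z :=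
            Finset.sum_nonneg fun i _ => mul_nonneg (hl i) (hz i)
          simp only [Fin.snoc_last]
          linarith
        · simpa using hl i
      · rw [Fin.sum_univ_castSucc]
        simp only [Fin.snoc_castSucc, Fin.snoc_last]
        ext x
        have hx := LinearMap.congr_fun he x
        simp only [LinearMap.add_apply, LinearMap.smul_apply, LinearMap.sum_apply, smul_eq_mul,
          mul_add, Finset.sum_add_distrib, ← mul_assoc, ← Finset.sum_mul] at hx
        simp only [LinearMap.add_apply, LinearMap.smul_apply, LinearMap.sum_apply, smul_eq_mul,
          sub_mul]
        linarith

/-- Farkas' lemma over a linearly ordered field. -/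
theorem farkas {ι : Type*} [Fintype ι] (A : ι → Module.Dual 𝕜 V) (b : Module.Dual 𝕜 V)
    (h : ∀ x, (∀ i, 0 ≤ A i x) → 0 ≤ b x) :
    ∃ l : ι → 𝕜, (∀ i, 0 ≤ l i) ∧ b = ∑ i, l i • A i := by
  obtain ⟨l, hl, he⟩ := farkas_fin (fun i => A ((Fintype.equivFin ι).symm i)) b
    (fun x hx => h x fun i => by simpa using hx (Fintype.equivFin ι i))
  refine ⟨fun i => l (Fintype.equivFin ι i), fun i => hl _, ?_⟩
  rw [he, ← (Fintype.equivFin ι).sum_comp]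
  simp

theorem exists_nat_mul_eq_natCast {ι : Type*} [Fintype ι] (l : ι → ℚ) (hl : ∀ i, 0 ≤ l i) :
    ∃ N : ℕ, 0 < N ∧ ∃ e : ι → ℕ, ∀ i, (N : ℚ) * l i = e i := by
  refine ⟨∏ i, (l i).den, Finset.prod_pos fun i _ => (l i).pos, ?_⟩
  refine ⟨fun i => ((∏ j, (l j).den) / (l i).den) * (l i).num.toNat, fun i => ?_⟩
  have hd : (l i).den ∣ ∏ j, (l j).den := Finset.dvd_prod_of_mem _ (Finset.mem_univ i)
  obtain ⟨k, hk⟩ := hd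
  have hn : (((l i).num.toNat : ℕ) : ℚ) = (l i).num := by
    have : (((l i).num.toNat : ℕ) : ℤ) = (l i).num :=
      Int.toNat_of_nonneg (Rat.num_nonneg.2 (hl i))
    exact_mod_cast this
  simp only [hk, Nat.mul_div_cancel_left _ (l i).pos]
  push_cast
  rw [hn]
  have h3 : (l i) * (l i).den = (l i).num := Rat.mul_den_eq_num _
  rw [← h3]
  ring

/-- Either some positive functional attains its minimum over the points `a j` at `b / m`, or a
multiple of `b` can be decreased in some coordinate within the Newton polyhedron. -/
theorem exists_pos_functional_or {n r : ℕ} (a : Fin r → Fin n → ℕ) (b : Fin n → ℕ) (m : ℕ) :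
    (∃ (u : Fin n → ℝ) (c : ℝ), (∀ i, 0 < u i) ∧ (∀ j, c ≤ ∑ k, (a j k : ℝ) * u k) ∧
      ∑ k, (b k : ℝ) * u k ≤ c * m) ∨
    ∃ (i : Fin n) (S : ℕ) (e : Fin r → ℕ), S * m = ∑ j, e j ∧
      ∀ k, (∑ j, e j * a j k) + (if k = i then 1 else 0) ≤ S * b k := by
  by_cases h : ∀ i : Fin n, ∃ (u : Fin n → ℚ) (c : ℚ), (∀ k, 0 ≤ u k) ∧ 0 < u i ∧
      (∀ j, c ≤ ∑ k, (a j k : ℚ) * u k) ∧ ∑ k, (b k : ℚ) * u k ≤ c * m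
  -- The functional indexed by i is only positive at coordinate i; the sum over all i is positive
  -- everywhere, and the inequalities add up.
  · left
    choose u c h1 h2 h3 h4 using h
    have key : ∀ x : Fin n → ℕ, ∑ k, (x k : ℝ) * (((∑ i, u i k : ℚ)) : ℝ) =
        ((∑ i, ∑ k, (x k : ℚ) * u i k : ℚ) : ℝ) := by
      intro x
      push_cast
      rw [Finset.sum_comm]
      simp_rw [Finset.mul_sum]
    refine ⟨fun k => ((∑ i, u i k : ℚ) : ℝ), ((∑ i, c i : ℚ) : ℝ), fun k => ?_, fun j => ?_, ?_⟩
    · have : 0 < ∑ i, u i k :=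
        Finset.sum_pos' (fun i _ => h1 i k) ⟨k, Finset.mem_univ k, h2 k⟩
      exact Rat.cast_pos.2 this
    · rw [key]
      exact_mod_cast Finset.sum_le_sum fun i _ => h3 i j
    · rw [key]
      have : (∑ i, ∑ k, (b k : ℚ) * u i k) ≤ (∑ i, c i) * m := by
        rw [Finset.sum_mul]
        exact Finset.sum_le_sum fun i _ => h4 i
      exact_mod_cast this
  · right
    push Not at h
    obtain ⟨i, hi⟩ := h
    let pr : Fin n → Module.Dual ℚ ((Fin n → ℚ) × ℚ) := fun k =>
      LinearMap.proj k ∘ₗ LinearMap.fst ℚ _ _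
    let L : (Fin n → ℕ) → ℕ → Module.Dual ℚ ((Fin n → ℚ) × ℚ) := fun x s =>
      (∑ k, (x k : ℚ) • pr k) - (s : ℚ) • LinearMap.snd ℚ _ _
    have hL : ∀ x s u c, L x s (u, c) = (∑ k, (x k : ℚ) * u k) - s * c := by
      intro x s u c
      simp [L, pr, LinearMap.sum_apply]
    -- Infeasibility at coordinate i says that u_i ≤ 0 follows from the remaining inequalities.
    -- Working over ℚ allows the Farkas coefficients to be cleared to natural numbers.
    obtain ⟨l, hl, he⟩ := farkas (𝕜 := ℚ) (ι := Fin r ⊕ (Fin n ⊕ Unit))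
      (Sum.elim (fun j => L (a j) 1) (Sum.elim pr (fun _ => - L b m))) (-(pr i)) (by
        rintro ⟨u, c⟩ hu
        have h1 := fun j => hu (Sum.inl j)
        have h2 := fun k => hu (Sum.inr (Sum.inl k))
        have h3 := hu (Sum.inr (Sum.inr ()))
        simp only [Sum.elim_inl, Sum.elim_inr, LinearMap.neg_apply, hL] at h1 h2 h3
        by_contra! hc
        have h4 : 0 < u i := by
          have : -(u i) < 0 := hc
          linarith
        have := hi u c h2 h4 (fun j => by have := h1 j; push_cast at this; linarith)
        linarith)
    obtain ⟨N, hN, e, hNe⟩ := exists_nat_mul_eq_natCast l hl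
    have he2 : ∀ (u : Fin n → ℚ) (c : ℚ), -((N : ℚ) * u i) = (∑ j, (e (Sum.inl j) : ℚ) *
        ((∑ k, (a j k : ℚ) * u k) - c)) + ((∑ k, (e (Sum.inr (Sum.inl k)) : ℚ) * u k) +
        -((e (Sum.inr (Sum.inr ())) : ℚ) * ((∑ k, (b k : ℚ) * u k) - m * c))) := by
      intro u c
      have := congrArg (fun f => (N : ℚ) * f (u, c)) he
      simp only [LinearMap.neg_apply, LinearMap.add_apply, LinearMap.sum_apply,
        LinearMap.smul_apply, Fintype.sum_sum_type, Sum.elim_inl, Sum.elim_inr, hL,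
        Finset.univ_unique, Finset.sum_singleton, mul_add, Finset.mul_sum, smul_eq_mul, ← mul_assoc, hNe] at this
      simp only [pr, LinearMap.comp_apply, LinearMap.fst_apply, LinearMap.proj_apply, mul_neg,
        Nat.cast_one, one_mul] at this
      rw [this]
    -- S is the cleared coefficient of the inequality for b. Evaluating the identity at (0, 1)
    -- compares degrees in t; evaluating at (e_k, 0) compares k-th coordinates.
    refine ⟨i, e (Sum.inr (Sum.inr ())), fun j => e (Sum.inl j), ?_, fun k => ?_⟩
    · have := he2 0 1
      simp only [Pi.zero_apply, mul_zero, Finset.sum_const_zero, zero_sub, mul_neg, mul_one,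
        Finset.sum_neg_distrib] at this
      have h2 : ((e (Sum.inr (Sum.inr ())) : ℚ) * m) = ∑ j, (e (Sum.inl j) : ℚ) := by linarith
      exact_mod_cast h2
    · have := he2 (Pi.single k 1) 0
      simp only [Pi.single_apply, mul_ite, mul_one, mul_zero, Finset.sum_ite_eq',
        Finset.mem_univ, if_true, sub_zero] at this
      have h2 : (∑ j, (e (Sum.inl j) : ℚ) * a j k) + e (Sum.inr (Sum.inl k)) +
          (if k = i then (N : ℚ) else 0) = e (Sum.inr (Sum.inr ())) * b k := by
        simp only [eq_comm (a := i)] at this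
        linarith
      have h3 : (∑ j, e (Sum.inl j) * a j k) + e (Sum.inr (Sum.inl k)) +
          (if k = i then N else 0) = e (Sum.inr (Sum.inr ())) * b k := by
        exact_mod_cast h2
      -- The coefficient of u_k ≥ 0 is dropped as slack, and N ≥ 1 is weakened to 1.
      dsimp only
      split_ifs at h3 ⊢ <;> omega

end Farkas

/-! ### Compact faces of the Newton polyhedron -/

section Faces

variable {n : ℕ}

theorem setOf_mem_convexHull_dotProduct_eq {S : Set (Fin n → ℝ)} {u : Fin n → ℝ} {c : ℝ}
    (h : ∀ v ∈ S, c ≤ v ⬝ᵥ u) :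
    {v ∈ convexHull ℝ S | v ⬝ᵥ u = c} = convexHull ℝ {v ∈ S | v ⬝ᵥ u = c} := by
  have hH : ∀ v ∈ convexHull ℝ {v ∈ S | v ⬝ᵥ u = c}, v ⬝ᵥ u = c := by
    refine convexHull_min (t := {v | v ⬝ᵥ u = c}) (fun v hv => hv.2) ?_
    intro v hv w hw s t _ _ hst
    simp only [Set.mem_ofPred_eq] at hv hw ⊢
    rw [add_dotProduct, smul_dotProduct, smul_dotProduct, hv, hw, ← add_smul, hst, one_smul]
  refine Set.Subset.antisymm ?_ fun v hv => ⟨convexHull_mono (fun _ h => h.1) hv, hH v hv⟩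
  rintro v ⟨hv, hvc⟩
  -- The right-hand set contains S and is convex: a proper convex combination of two of its points
  -- is strictly above level c unless both lie in the smaller hull.
  have : convexHull ℝ S ⊆ {v | v ∈ convexHull ℝ {v ∈ S | v ⬝ᵥ u = c} ∨ c < v ⬝ᵥ u} := by
    refine convexHull_min (fun v hv => ?_) ?_
    · rcases (h v hv).eq_or_lt with h1 | h1
      · exact Or.inl (subset_convexHull ℝ _ ⟨hv, h1.symm⟩)
      · exact Or.inr h1
    · intro v hv w hw s t hs ht hst
      rcases hs.eq_or_lt with rfl | hs
      · obtain rfl : t = 1 := by linarith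
        simpa using hw
      rcases ht.eq_or_lt with rfl | ht
      · obtain rfl : s = 1 := by linarith
        simpa using hv
      by_cases hvw : v ∈ convexHull ℝ {v ∈ S | v ⬝ᵥ u = c} ∧
          w ∈ convexHull ℝ {v ∈ S | v ⬝ᵥ u = c}
      · exact Or.inl ((convex_convexHull ℝ _) hvw.1 hvw.2 hs.le ht.le hst)
      · right
        rw [add_dotProduct, smul_dotProduct, smul_dotProduct, smul_eq_mul, smul_eq_mul]
        have e : c = s * c + t * c := by rw [← add_mul, hst, one_mul]
        rcases hv with hv | hv
        · rcases hw with hw | hw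
          · exact absurd ⟨hv, hw⟩ hvw
          · nlinarith [hH v hv]
        · have : c ≤ w ⬝ᵥ u := by
            rcases hw with hw | hw
            · exact (hH w hw).ge
            · exact hw.le
          nlinarith
  exact (this hv).resolve_right (by rw [hvc]; exact lt_irrefl c)

/-- `F` is cut out of `X` by a lower bound of a functional with positive coefficients. -/
def IsPositiveFace (X F : Set (Fin n → ℝ)) : Prop :=
  ∃ (u : Fin n → ℝ) (c : ℝ), (∀ i, 0 < u i) ∧ (∀ v ∈ X, c ≤ v ⬝ᵥ u) ∧ F = {v ∈ X | v ⬝ᵥ u = c}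

variable {K : Type*} [Field K]

theorem exponents_add {J : Ideal (MvPolynomial (Fin n) K)} {b : Fin n →₀ ℕ}
    (hb : b ∈ exponents J) (d : Fin n →₀ ℕ) : b + d ∈ exponents J := by
  have := J.mul_mem_right (monomial d (1 : K)) hb
  rwa [monomial_mul, one_mul] at this

theorem toPoint_add (b d : Fin n →₀ ℕ) : toPoint (b + d) = toPoint b + toPoint d := by
  ext i
  simp [toPoint]

theorem newtonPolyhedron_add_single {J : Ideal (MvPolynomial (Fin n) K)} {v : Fin n → ℝ}
    (hv : v ∈ newtonPolyhedron J) (i : Fin n) (N : ℕ) :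
    v + Pi.single i (N : ℝ) ∈ newtonPolyhedron J := by
  have : newtonPolyhedron J ⊆ (fun z => z + Pi.single i (N : ℝ)) ⁻¹' newtonPolyhedron J := by
    refine convexHull_min ?_ ((convex_convexHull ℝ _).translate_preimage_left _)
    rintro _ ⟨b, hb, rfl⟩
    refine subset_convexHull ℝ _ ⟨b + Finsupp.single i N, exponents_add hb _, ?_⟩
    rw [toPoint_add]
    congr 1
    ext k
    simp [toPoint, Finsupp.single_apply, Pi.single_apply, eq_comm]
  exact this hv

theorem toPoint_mem_newtonPolyhedron {J : Ideal (MvPolynomial (Fin n) K)} {b : Fin n →₀ ℕ}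
    (hb : b ∈ exponents J) : toPoint b ∈ newtonPolyhedron J :=
  subset_convexHull ℝ _ ⟨b, hb, rfl⟩

/-- The polyhedron is closed under adding multiples of each e_i, which forces u_i ≥ 0. If u_i = 0,
the face would contain an unbounded sequence in direction e_i. -/
theorem isPositiveFace_of_isCompact {J : Ideal (MvPolynomial (Fin n) K)} {F : Set (Fin n → ℝ)}
    (hF : IsFace (newtonPolyhedron J) F) (hc : IsCompact F) :
    IsPositiveFace (newtonPolyhedron J) F := by
  -- The bound c need not be attained, so the level -1, below all values, cuts out the empty face.
  have hempty : IsPositiveFace (newtonPolyhedron J) (∅ : Set (Fin n → ℝ)) := by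
    have hnn : ∀ v ∈ newtonPolyhedron J, (0 : ℝ) ≤ v ⬝ᵥ 1 := by
      refine convexHull_min (t := {v | 0 ≤ v ⬝ᵥ 1}) ?_ ?_
      · rintro _ ⟨b, -, rfl⟩
        simp only [Set.mem_ofPred_eq, dotProduct_one]
        exact Finset.sum_nonneg fun i _ => Nat.cast_nonneg (b i)
      · intro v hv w hw s t hs ht _
        simp only [Set.mem_ofPred_eq, add_dotProduct, smul_dotProduct, smul_eq_mul] at hv hw ⊢
        positivity
    refine ⟨1, -1, fun i => one_pos, fun v hv => by linarith [hnn v hv], ?_⟩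
    symm
    rw [Set.eq_empty_iff_forall_notMem]
    rintro v ⟨hv, hv1⟩
    linarith [hnn v hv]
  have hbdd : ∀ v ∈ F, ∀ i : Fin n, ∃ N : ℕ, v + Pi.single i (N : ℝ) ∉ F := by
    intro v hv i
    obtain ⟨R, hR⟩ := hc.isBounded.exists_norm_le
    obtain ⟨N, hN⟩ := exists_nat_gt (R - v i)
    refine ⟨N, fun h => ?_⟩
    have h1 := (norm_le_pi_norm (v + Pi.single i (N : ℝ)) i).trans (hR _ h)
    simp only [Pi.add_apply, Pi.single_eq_same, Real.norm_eq_abs] at h1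
    linarith [le_abs_self (v i + N)]
  rcases F.eq_empty_or_nonempty with rfl | ⟨v, hv⟩
  · exact hempty
  rcases hF with rfl | rfl | ⟨u, c, ⟨-, hX, -⟩, rfl⟩
  · exact hempty
  -- A nonempty polyhedron is unbounded in every coordinate direction, so it is compact only for n =
  -- 0.
  · have : IsEmpty (Fin n) := ⟨fun i => by
      obtain ⟨N, hN⟩ := hbdd v hv i
      exact hN (newtonPolyhedron_add_single hv i N)⟩
    exact ⟨0, 0, fun i => isEmptyElim i, fun v _ => by simp, by simp⟩
  · refine ⟨u, c, fun i => ?_, hX, rfl⟩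
    have h1 := hX _ (newtonPolyhedron_add_single hv.1 i 1)
    have e : ∀ N : ℕ, (v + Pi.single i (N : ℝ)) ⬝ᵥ u = c + N * u i := fun N => by
      rw [add_dotProduct, single_dotProduct, hv.2]
    rw [e] at h1
    push_cast at h1
    refine lt_of_le_of_ne (by linarith) fun h0 => ?_
    obtain ⟨N, hN⟩ := hbdd v hv i
    exact hN ⟨newtonPolyhedron_add_single hv.1 i N, by rw [e, ← h0, mul_zero, add_zero]⟩

theorem mem_minGenExponents_of_isMinOn {J : Ideal (MvPolynomial (Fin n) K)} {u : Fin n → ℝ}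
    {c : ℝ} (hu : ∀ i, 0 < u i) (hX : ∀ v ∈ newtonPolyhedron J, c ≤ v ⬝ᵥ u) {b : Fin n →₀ ℕ}
    (hb : b ∈ exponents J) (hbc : toPoint b ⬝ᵥ u = c) : b ∈ minGenExponents J := by
  refine ⟨hb, fun d hd hdb => ?_⟩
  by_contra hbd
  obtain ⟨i, hi⟩ : ∃ i, d i < b i := by
    by_contra! h
    exact hbd h
  have : toPoint d ⬝ᵥ u < toPoint b ⬝ᵥ u := by
    refine Finset.sum_lt_sum (fun k _ => ?_) ⟨i, Finset.mem_univ i, ?_⟩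
    · exact mul_le_mul_of_nonneg_right (Nat.cast_le.2 (hdb k)) (hu k).le
    · exact mul_lt_mul_of_pos_right (Nat.cast_lt.2 hi) (hu i)
  linarith [hX _ (toPoint_mem_newtonPolyhedron hd)]

/-- A functional with positive coefficients strictly decreases under proper division, so the
exponents at which it reaches the bound c are those of minimal generators. Hence such faces are
compact and finite in number. -/
theorem IsPositiveFace.eq_convexHull {r : ℕ} {J : Ideal (MvPolynomial (Fin n) K)}
    (a : Fin r ≃ minGenExponents J) {F : Set (Fin n → ℝ)}
    (hF : IsPositiveFace (newtonPolyhedron J) F) :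
    F = convexHull ℝ ((fun j => toPoint (a j : Fin n →₀ ℕ)) ''
      {j | toPoint (a j : Fin n →₀ ℕ) ∈ F}) := by
  obtain ⟨u, c, hu, hX, rfl⟩ := hF
  conv_lhs => rw [newtonPolyhedron, setOf_mem_convexHull_dotProduct_eq
    (fun v hv => hX v (subset_convexHull ℝ _ hv))]
  congr 1
  ext v
  constructor
  · rintro ⟨⟨b, hb, rfl⟩, hbc⟩
    obtain ⟨j, hj⟩ := a.surjective ⟨b, mem_minGenExponents_of_isMinOn hu hX hb hbc⟩
    refine ⟨j, ?_, by simp [hj]⟩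
    simp only [Set.mem_ofPred_eq, hj]
    exact ⟨toPoint_mem_newtonPolyhedron hb, hbc⟩
  · rintro ⟨j, hj, rfl⟩
    exact ⟨⟨_, (a j).2.1, rfl⟩, hj.2⟩

theorem IsPositiveFace.isFace {J : Ideal (MvPolynomial (Fin n) K)} {F : Set (Fin n → ℝ)}
    (hF : IsPositiveFace (newtonPolyhedron J) F) : IsFace (newtonPolyhedron J) F := by
  rcases F.eq_empty_or_nonempty with rfl | ⟨v, hv⟩
  · exact Or.inl rfl
  obtain ⟨u, c, hu, hX, rfl⟩ := hF
  rcases isEmpty_or_nonempty (Fin n) with hn | ⟨⟨i⟩⟩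
  · refine Or.inr (Or.inl (Set.Subset.antisymm (fun _ h => h.1) fun w hw => ?_))
    rwa [Subsingleton.elim w v]
  · exact Or.inr (Or.inr ⟨u, c, ⟨fun h => (hu i).ne' (congrFun h i), hX, v, hv⟩, rfl⟩)

theorem isFace_and_isCompact_iff {r : ℕ} {J : Ideal (MvPolynomial (Fin n) K)}
    (a : Fin r ≃ minGenExponents J) {F : Set (Fin n → ℝ)} :
    IsFace (newtonPolyhedron J) F ∧ IsCompact F ↔ IsPositiveFace (newtonPolyhedron J) F := by
  refine ⟨fun h => isPositiveFace_of_isCompact h.1 h.2, fun h => ⟨h.isFace, ?_⟩⟩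
  rw [h.eq_convexHull a]
  exact (Set.toFinite _).isCompact_convexHull ℝ

theorem isPositiveFace_of_mem_maximalCompactFaces {J : Ideal (MvPolynomial (Fin n) K)}
    {F : Set (Fin n → ℝ)} (hF : F ∈ maximalCompactFaces (newtonPolyhedron J)) :
    IsPositiveFace (newtonPolyhedron J) F := by
  have h : Maximal (fun G => IsFace (newtonPolyhedron J) G ∧ IsCompact G) F := hF
  exact isPositiveFace_of_isCompact h.prop.1 h.prop.2

theorem exists_maximalCompactFaces_ge {r : ℕ} {J : Ideal (MvPolynomial (Fin n) K)}
    (a : Fin r ≃ minGenExponents J) {F : Set (Fin n → ℝ)}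
    (hF : IsPositiveFace (newtonPolyhedron J) F) :
    ∃ G ∈ maximalCompactFaces (newtonPolyhedron J), F ⊆ G := by
  have hfin : {G | IsFace (newtonPolyhedron J) G ∧ IsCompact G}.Finite := by
    refine (Set.finite_range fun s : Set (Fin r) =>
      convexHull ℝ ((fun j => toPoint (a j : Fin n →₀ ℕ)) '' s)).subset fun G hG => ?_
    exact ⟨_, (((isFace_and_isCompact_iff a).1 hG).eq_convexHull a).symm⟩
  obtain ⟨G, hFG, hG⟩ := hfin.exists_le_maximal ((isFace_and_isCompact_iff a).2 hF)
  exact ⟨G, hG, hFG⟩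

theorem exists_minGenExponents_le {J : Ideal (MvPolynomial (Fin n) K)} {b : Fin n →₀ ℕ}
    (hb : b ∈ exponents J) : ∃ d ∈ minGenExponents J, d ≤ b := by
  obtain ⟨d, hdb, hd⟩ := exists_minimal_le_of_wellFoundedLT (· ∈ exponents J) b hb
  exact ⟨d, hd, hdb⟩

end Faces

end ExtremalIdeal

/-! ### The toric maps of faces and their multigrading -/

namespace ExtremalIdeal

open MvPolynomial

variable {K : Type*} [Field K] {n r : ℕ}

/-- The degree of `x^b t^m` with respect to which `y_j` and `x^{a_j} t` have the same degree. -/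
noncomputable def multidegree (a : Fin r → Fin n →₀ ℕ) : (Fin r →₀ ℕ) →+ (Fin n →₀ ℕ) × ℕ :=
  Finsupp.weight fun j => (a j, 1)

theorem multidegree_eq (a : Fin r → Fin n →₀ ℕ) (α : Fin r →₀ ℕ) :
    multidegree a α = (∑ j, α j • a j, ∑ j, α j) := by
  rw [multidegree, Finsupp.weight_apply, Finsupp.sum_fintype _ _ (by simp)]
  ext <;> simp [Prod.fst_sum, Prod.snd_sum]

open Classical in
/-- The algebra map sending `y_j` to `x^{a_j} t` if `a_j ∈ F` and to `0` otherwise. -/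
noncomputable def faceMap (K : Type*) [Field K] (a : Fin r → Fin n →₀ ℕ) (F : Set (Fin n → ℝ)) :
    MvPolynomial (Fin r) K →ₐ[K] Polynomial (MvPolynomial (Fin n) K) :=
  aeval fun j => if toPoint (a j) ∈ F then monomialT K (a j) else 0

theorem faceMap_X_of_mem {a : Fin r → Fin n →₀ ℕ} {F : Set (Fin n → ℝ)} {j : Fin r}
    (h : toPoint (a j) ∈ F) : faceMap K a F (X j) = monomialT K (a j) := by
  rw [faceMap, aeval_X, if_pos h]

theorem faceMap_X_of_notMem {a : Fin r → Fin n →₀ ℕ} {F : Set (Fin n → ℝ)} {j : Fin r}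
    (h : toPoint (a j) ∉ F) : faceMap K a F (X j) = 0 := by
  rw [faceMap, aeval_X, if_neg h]

/-- The exponent `α` only involves variables `y_j` with `a_j ∈ F`. -/
def SupportedOn (a : Fin r → Fin n →₀ ℕ) (F : Set (Fin n → ℝ)) (α : Fin r →₀ ℕ) : Prop :=
  ∀ j, α j ≠ 0 → toPoint (a j) ∈ F

theorem faceMap_monomial_of_supportedOn {a : Fin r → Fin n →₀ ℕ} {F : Set (Fin n → ℝ)}
    {α : Fin r →₀ ℕ} (h : SupportedOn a F α) (k : K) :
    faceMap K a F (monomial α k) =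
      Polynomial.monomial (multidegree a α).2 (monomial (multidegree a α).1 k) := by
  classical
  have key : (α.prod fun j e => Polynomial.monomial e (monomial (e • a j) (1 : K))) =
      Polynomial.monomial (multidegree a α).2 (monomial (multidegree a α).1 (1 : K)) := by
    clear h
    induction α using Finsupp.induction_linear with
    | zero => simp
    | add f g hf hg =>
      rw [Finsupp.prod_add_index', hf, hg, Polynomial.monomial_mul_monomial, monomial_mul, map_add]
      · simp
      · intro j
        simp
      · intro j e e'
        rw [Polynomial.monomial_mul_monomial, monomial_mul, add_smul, one_mul]
    | single j e =>
      rw [Finsupp.prod_single_index (by simp), multidegree, Finsupp.weight_single]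
      simp
  rw [faceMap, aeval_monomial]
  have h1 : (α.prod fun j e => (if toPoint (a j) ∈ F then monomialT K (a j) else 0) ^ e) =
      α.prod fun j e => Polynomial.monomial e (monomial (e • a j) (1 : K)) := by
    refine Finsupp.prod_congr fun j hj => ?_
    rw [if_pos (h j (Finsupp.mem_support_iff.1 hj)), monomialT, Polynomial.monomial_pow,
      monomial_pow]
    simp
  rw [h1, key, IsScalarTower.algebraMap_apply K (MvPolynomial (Fin n) K),
    ← Polynomial.C_eq_algebraMap, Polynomial.C_mul_monomial, MvPolynomial.algebraMap_eq,
    C_mul_monomial, mul_one]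

theorem faceMap_monomial_of_not_supportedOn {a : Fin r → Fin n →₀ ℕ} {F : Set (Fin n → ℝ)}
    {α : Fin r →₀ ℕ} (h : ¬ SupportedOn a F α) (k : K) : faceMap K a F (monomial α k) = 0 := by
  classical
  obtain ⟨j, hj, hjF⟩ : ∃ j, α j ≠ 0 ∧ toPoint (a j) ∉ F := by
    simpa [SupportedOn] using h
  rw [faceMap, aeval_monomial, Finsupp.prod,
    Finset.prod_eq_zero (Finsupp.mem_support_iff.2 hj), mul_zero]
  rw [if_neg hjF, zero_pow hj]

/-- `faceMap` respects the multigrading, so its kernel contains every homogeneous component of each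
of its elements. -/
theorem faceMap_weightedHomogeneousComponent (a : Fin r → Fin n →₀ ℕ) (F : Set (Fin n → ℝ))
    (g : MvPolynomial (Fin r) K) (w : (Fin n →₀ ℕ) × ℕ) :
    faceMap K a F (weightedHomogeneousComponent (fun j => (a j, 1)) w g) =
      Polynomial.monomial w.2 (monomial w.1 (((faceMap K a F g).coeff w.2).coeff w.1)) := by
  classical
  induction g using MvPolynomial.induction_on' with
  | add p q hp hq => simp only [map_add, hp, hq, Polynomial.coeff_add, coeff_add]
  | monomial α k =>
    have hα : (monomial α k).IsWeightedHomogeneous (fun j => (a j, 1)) (multidegree a α) :=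
      isWeightedHomogeneous_monomial _ _ _ rfl
    rw [weightedHomogeneousComponent_of_mem hα]
    by_cases hs : SupportedOn a F α
    · rw [faceMap_monomial_of_supportedOn hs]
      split_ifs with hw
      · rw [faceMap_monomial_of_supportedOn hs, hw]
        simp
      · rw [Polynomial.coeff_monomial]
        split_ifs with h2
        · rw [coeff_monomial, if_neg, map_zero, map_zero, map_zero]
          intro h1
          exact hw (Prod.ext h1.symm h2.symm)
        · simp
    · rw [faceMap_monomial_of_not_supportedOn hs]
      split_ifs
      · rw [faceMap_monomial_of_not_supportedOn hs]
        simp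
      · simp

theorem faceMap_rename {a : Fin r → Fin n →₀ ℕ} {F G : Set (Fin n → ℝ)} (hFG : F ⊆ G)
    (h : MvPolynomial {j : Fin r // toPoint (a j) ∈ F} K) :
    faceMap K a G (rename Subtype.val h) = (toricMap K a F h : Polynomial _) := by
  have : (faceMap K a G).comp (rename Subtype.val) =
      (toricRing K a F).val.comp (toricMap K a F) := by
    refine MvPolynomial.algHom_ext fun j => ?_
    simp only [AlgHom.comp_apply, rename_X, toricMap, aeval_X]
    exact faceMap_X_of_mem (hFG j.2)
  exact DFunLike.congr_fun this h

theorem idealB_le_ker_faceMap {a : Fin r → Fin n →₀ ℕ} {F G : Set (Fin n → ℝ)} (hFG : F ⊆ G) :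
    idealB K a F ≤ RingHom.ker (faceMap K a G) := by
  rw [idealB, Ideal.map_le_iff_le_comap]
  intro h hh
  rw [Ideal.mem_comap, RingHom.mem_ker]
  refine (faceMap_rename hFG h).trans ?_
  rw [RingHom.mem_ker] at hh
  rw [hh, ZeroMemClass.coe_zero]

theorem ker_faceMap (a : Fin r → Fin n →₀ ℕ) (F : Set (Fin n → ℝ)) :
    RingHom.ker (faceMap K a F) = idealP K a F ⊔ idealB K a F := by
  have hP : idealP K a F ≤ RingHom.ker (faceMap K a F) := by
    rw [idealP, Ideal.span_le]
    rintro _ ⟨j, hj, rfl⟩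
    exact faceMap_X_of_notMem hj
  refine le_antisymm (fun g hg => ?_) (sup_le hP (idealB_le_ker_faceMap subset_rfl))
  -- Setting the variables outside F to zero changes g only modulo P_F. What remains is a polynomial
  -- in the variables of F, where the kernel is B_F.
  have hdiff : g - rename Subtype.val (killCompl (Subtype.val_injective
      (p := fun j => toPoint (a j) ∈ F)) g) ∈ idealP K a F := by
    rw [← Ideal.Quotient.mk_eq_mk_iff_sub_mem]
    have : Ideal.Quotient.mkₐ K (idealP K a F) =
        (Ideal.Quotient.mkₐ K (idealP K a F)).comp ((rename Subtype.val).comp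
          (killCompl (Subtype.val_injective (p := fun j => toPoint (a j) ∈ F)))) := by
      refine MvPolynomial.algHom_ext fun j => ?_
      by_cases hj : toPoint (a j) ∈ F
      · have := killCompl_rename_app (R := K)
          (Subtype.val_injective (p := fun j => toPoint (a j) ∈ F)) (X ⟨j, hj⟩)
        rw [rename_X] at this
        simp only [AlgHom.comp_apply, this, rename_X]
      · have : killCompl (Subtype.val_injective (p := fun j => toPoint (a j) ∈ F)) (X j) =
            (0 : MvPolynomial _ K) := by
          rw [killCompl, aeval_X, dif_neg]
          simpa using hj
        simp only [AlgHom.comp_apply, this, map_zero]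
        exact Ideal.Quotient.eq_zero_iff_mem.2 (Ideal.subset_span ⟨j, hj, rfl⟩)
    exact DFunLike.congr_fun this g
  rw [← sub_add_cancel g (rename Subtype.val (killCompl (Subtype.val_injective
      (p := fun j => toPoint (a j) ∈ F)) g))]
  refine Submodule.add_mem_sup hdiff (Ideal.mem_map_of_mem _ ?_)
  have h1 := hP hdiff
  rw [RingHom.mem_ker, map_sub, RingHom.mem_ker.1 hg, zero_sub, neg_eq_zero,
    faceMap_rename subset_rfl] at h1
  exact Subtype.ext h1

theorem mem_idealB_of_supportedOn {a : Fin r → Fin n →₀ ℕ} {F : Set (Fin n → ℝ)}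
    {g : MvPolynomial (Fin r) K} (hs : ∀ α ∈ g.support, SupportedOn a F α)
    (hg : faceMap K a F g = 0) : g ∈ idealB K a F := by
  obtain ⟨h, rfl⟩ := exists_rename_eq_of_vars_subset_range g
    (Subtype.val : {j : Fin r // toPoint (a j) ∈ F} → Fin r) Subtype.val_injective (by
      intro j hj
      obtain ⟨α, hα, hjα⟩ := (mem_vars_iff_mem_support j).1 hj
      exact ⟨⟨j, hs α hα j (Finsupp.mem_support_iff.1 hjα)⟩, rfl⟩)
  rw [faceMap_rename subset_rfl] at hg
  exact Ideal.mem_map_of_mem _ (Subtype.ext hg)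

/-- The signed distance `⟨b, u⟩ - c m` of `x^b t^m` from the cone over `{v | ⟨v, u⟩ = c}`. -/
noncomputable def excess (u : Fin n → ℝ) (c : ℝ) (w : (Fin n →₀ ℕ) × ℕ) : ℝ :=
  toPoint w.1 ⬝ᵥ u - c * w.2

theorem excess_add (u : Fin n → ℝ) (c : ℝ) (v w : (Fin n →₀ ℕ) × ℕ) :
    excess u c (v + w) = excess u c v + excess u c w := by
  simp only [excess, Prod.fst_add, Prod.snd_add, toPoint_add, add_dotProduct, Nat.cast_add]
  ring

theorem excess_multidegree (u : Fin n → ℝ) (c : ℝ) (a : Fin r → Fin n →₀ ℕ) (α : Fin r →₀ ℕ) :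
    excess u c (multidegree a α) = ∑ j, α j * (toPoint (a j) ⬝ᵥ u - c) := by
  simp only [mul_sub, Finset.sum_sub_distrib, multidegree_eq, excess]
  congr 1
  · simp only [toPoint, dotProduct, Finsupp.coe_finsetSum, Finset.sum_apply, Finsupp.smul_apply,
      smul_eq_mul, Nat.cast_sum, Nat.cast_mul, Finset.sum_mul, Finset.mul_sum, mul_assoc]
    exact Finset.sum_comm
  · rw [Nat.cast_sum, Finset.mul_sum]
    exact Finset.sum_congr rfl fun j _ => mul_comm _ _

section Faces

variable {X' : Set (Fin n → ℝ)} {u : Fin n → ℝ} {c : ℝ} {a : Fin r → Fin n →₀ ℕ}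

/-- The excess is a sum of nonnegative terms α_j (⟨a_j, u⟩ - c), so it is ≤ 0 only if each term
vanishes. In particular, being supported on the face depends only on the degree of α. -/
theorem supportedOn_iff_excess_le (ha : ∀ j, toPoint (a j) ∈ X') (hX : ∀ v ∈ X', c ≤ v ⬝ᵥ u)
    (α : Fin r →₀ ℕ) :
    SupportedOn a {v ∈ X' | v ⬝ᵥ u = c} α ↔ excess u c (multidegree a α) ≤ 0 := by
  have hnn : ∀ j ∈ Finset.univ, 0 ≤ (α j : ℝ) * (toPoint (a j) ⬝ᵥ u - c) := fun j _ =>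
    mul_nonneg (Nat.cast_nonneg _) (sub_nonneg.2 (hX _ (ha j)))
  rw [excess_multidegree]
  constructor
  · intro h
    refine (Finset.sum_eq_zero fun j _ => ?_).le
    by_cases hj : α j = 0
    · simp [hj]
    · rw [(h j hj).2, sub_self, mul_zero]
  · intro h j hj
    have := (Finset.sum_eq_zero_iff_of_nonneg hnn).1 (le_antisymm h (Finset.sum_nonneg hnn)) j
      (Finset.mem_univ j)
    rcases mul_eq_zero.1 this with h0 | h0
    · exact absurd (Nat.cast_eq_zero.1 h0) hj
    · exact ⟨ha j, sub_eq_zero.1 h0⟩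

/-- The map of a face is the full presentation of the Rees algebra truncated to the degrees of
excess ≤ 0. This links elements of D to the kernels for faces. -/
theorem coeff_faceMap (ha : ∀ j, toPoint (a j) ∈ X') (hX : ∀ v ∈ X', c ≤ v ⬝ᵥ u)
    (g : MvPolynomial (Fin r) K) (w : (Fin n →₀ ℕ) × ℕ) :
    ((faceMap K a {v ∈ X' | v ⬝ᵥ u = c} g).coeff w.2).coeff w.1 =
      if excess u c w ≤ 0 then ((faceMap K a Set.univ g).coeff w.2).coeff w.1 else 0 := by
  classical
  induction g using MvPolynomial.induction_on' with
  | add p q hp hq =>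
    simp only [map_add, Polynomial.coeff_add, coeff_add, hp, hq]
    split_ifs <;> simp
  | monomial α k =>
    rw [faceMap_monomial_of_supportedOn (F := Set.univ) (fun _ _ => Set.mem_univ _)]
    by_cases hw : multidegree a α = w
    · rw [← hw]
      split_ifs with h
      · rw [faceMap_monomial_of_supportedOn ((supportedOn_iff_excess_le ha hX α).2 h)]
      · rw [faceMap_monomial_of_not_supportedOn
          (fun h' => h ((supportedOn_iff_excess_le ha hX α).1 h'))]
        simp
    · have h0 : ((Polynomial.monomial (multidegree a α).2
          (monomial (multidegree a α).1 k)).coeff w.2).coeff w.1 = 0 := by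
        rw [Polynomial.coeff_monomial]
        split_ifs with h2
        · rw [coeff_monomial, if_neg]
          exact fun h1 => hw (Prod.ext h1 h2)
        · simp
      rw [h0, ite_self]
      by_cases hs : SupportedOn a {v ∈ X' | v ⬝ᵥ u = c} α
      · rw [faceMap_monomial_of_supportedOn hs, h0]
      · rw [faceMap_monomial_of_not_supportedOn hs]
        simp

end Faces

/-! ### The Rees algebra, the fiber ideal and the three inclusions -/

section Rees

variable {J : Ideal (MvPolynomial (Fin n) K)}

/-- The presentation of the Rees algebra over the polynomial ring in the generators. -/
noncomputable def reesMap (J : Ideal (MvPolynomial (Fin n) K)) (a : Fin r ≃ minGenExponents J) :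
    MvPolynomial (Fin r) K →ₐ[K] reesAlgebra J :=
  aeval fun j => ⟨monomialT K (a j : Fin n →₀ ℕ), monomialT_mem_reesAlgebra (a j).2.1⟩

theorem coe_reesMap (a : Fin r ≃ minGenExponents J) (g : MvPolynomial (Fin r) K) :
    (reesMap J a g : Polynomial (MvPolynomial (Fin n) K)) =
      faceMap K (fun j => (a j : Fin n →₀ ℕ)) Set.univ g := by
  have : ((reesAlgebra J).val.restrictScalars K).comp (reesMap J a) =
      faceMap K (fun j => (a j : Fin n →₀ ℕ)) Set.univ := by
    refine MvPolynomial.algHom_ext fun j => ?_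
    rw [faceMap_X_of_mem (Set.mem_univ _)]
    simp [reesMap]
  exact DFunLike.congr_fun this g

theorem mem_fiberIdeal_iff (a : Fin r ≃ minGenExponents J) (g : MvPolynomial (Fin r) K) :
    g ∈ fiberIdeal J a ↔ reesMap J a g ∈
      (Ideal.span (Set.range (X : Fin n → MvPolynomial (Fin n) K))).map
        (algebraMap (MvPolynomial (Fin n) K) (reesAlgebra J)) := by
  have : fiberMap J a = (Ideal.Quotient.mkₐ K _).comp (reesMap J a) := by
    refine MvPolynomial.algHom_ext fun j => ?_
    simp [fiberMap, reesMap]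
  rw [fiberIdeal, RingHom.mem_ker, this, ← Ideal.Quotient.eq_zero_iff_mem]
  rfl

theorem idealB_le_fiberIdeal (a : Fin r ≃ minGenExponents J) (F : Set (Fin n → ℝ)) :
    idealB K (fun j => (a j : Fin n →₀ ℕ)) F ≤ fiberIdeal J a := by
  intro g hg
  have h1 := idealB_le_ker_faceMap (Set.subset_univ F) hg
  rw [RingHom.mem_ker, ← coe_reesMap] at h1
  have h2 : reesMap J a g = 0 := Subtype.ext h1
  rw [mem_fiberIdeal_iff, h2]
  exact zero_mem _

theorem support_subset_exponents (hJ : IsMonomialIdeal J) {f : MvPolynomial (Fin n) K}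
    (hf : f ∈ J) {b : Fin n →₀ ℕ} (hb : b ∈ f.support) : b ∈ exponents J := by
  obtain ⟨S, rfl⟩ := hJ
  obtain ⟨d, hd, hdb⟩ := mem_ideal_span_monomial_image.1 hf b hb
  obtain ⟨e, rfl⟩ := exists_add_of_le hdb
  have hd' : monomial d (1 : K) ∈ Ideal.span ((fun a => monomial a (1 : K)) '' S) :=
    Ideal.subset_span ⟨d, hd, rfl⟩
  exact exponents_add hd' e

variable {u : Fin n → ℝ} {c : ℝ}

theorem dotProduct_nonneg (hu : ∀ i, 0 < u i) (b : Fin n →₀ ℕ) : 0 ≤ toPoint b ⬝ᵥ u :=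
  Finset.sum_nonneg fun i _ => mul_nonneg (Nat.cast_nonneg (b i)) (hu i).le

theorem excess_nonneg_of_mem_pow (hJ : IsMonomialIdeal J) (hu : ∀ i, 0 < u i)
    (hX : ∀ v ∈ newtonPolyhedron J, c ≤ v ⬝ᵥ u) (m : ℕ) {f : MvPolynomial (Fin n) K}
    (hf : f ∈ J ^ m) : ∀ b ∈ f.support, 0 ≤ excess u c (b, m) := by
  classical
  induction m generalizing f with
  | zero =>
    intro b _
    simpa [excess] using dotProduct_nonneg hu b
  | succ m ih =>
    rw [pow_succ] at hf
    induction hf using Submodule.mul_induction_on' with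
    | mem_mul_mem p hp q hq =>
      intro b hb
      obtain ⟨b₁, h₁, b₂, h₂, rfl⟩ := Finset.mem_add.1 (support_mul p q hb)
      have e : ((b₁ + b₂, m + 1) : (Fin n →₀ ℕ) × ℕ) = (b₁, m) + (b₂, 1) := rfl
      rw [e, excess_add]
      refine add_nonneg (ih hp b₁ h₁) ?_
      have := hX _ (toPoint_mem_newtonPolyhedron (support_subset_exponents hJ hq h₂))
      simpa [excess] using this
    | add p _ q _ hp hq =>
      intro b hb
      rcases Finset.mem_union.1 (support_add hb) with h | h
      exacts [hp b h, hq b h]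

/-- Each x_i has excess u_i > 0, and multiplying by an element of the Rees algebra adds a
nonnegative excess. -/
theorem excess_pos_of_mem_map (hJ : IsMonomialIdeal J) (hu : ∀ i, 0 < u i)
    (hX : ∀ v ∈ newtonPolyhedron J, c ≤ v ⬝ᵥ u) {p : reesAlgebra J}
    (hp : p ∈ (Ideal.span (Set.range (X : Fin n → MvPolynomial (Fin n) K))).map
        (algebraMap (MvPolynomial (Fin n) K) (reesAlgebra J))) :
    ∀ m : ℕ, ∀ b ∈ ((p : Polynomial (MvPolynomial (Fin n) K)).coeff m).support,
      0 < excess u c (b, m) := by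
  classical
  rw [Ideal.map_span] at hp
  induction hp using Submodule.span_induction with
  | mem p hp =>
    obtain ⟨_, ⟨i, rfl⟩, rfl⟩ := hp
    intro m b hb
    have e : ((algebraMap (MvPolynomial (Fin n) K) (reesAlgebra J) (X i) : reesAlgebra J) :
      Polynomial (MvPolynomial (Fin n) K)) = Polynomial.C (X i) := rfl
    rw [e, Polynomial.coeff_C] at hb
    split_ifs at hb with hm
    · subst hm
      rw [support_X, Finset.mem_singleton] at hb
      subst hb
      have : toPoint (Finsupp.single i 1) = Pi.single i 1 := by
        ext k
        simp [toPoint, Finsupp.single_apply, Pi.single_apply, eq_comm]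
      simpa [excess, this] using hu i
    · simp at hb
  | zero => simp
  | add p q _ _ hp hq =>
    intro m b hb
    rw [Subalgebra.coe_add, Polynomial.coeff_add] at hb
    rcases Finset.mem_union.1 (support_add hb) with h | h
    exacts [hp m b h, hq m b h]
  | smul s p _ hp =>
    intro m b hb
    rw [smul_eq_mul, Subalgebra.coe_mul, Polynomial.coeff_mul] at hb
    obtain ⟨⟨m₁, m₂⟩, hm, hb⟩ := Finset.mem_biUnion.1 (support_sum hb)
    obtain ⟨b₁, h₁, b₂, h₂, rfl⟩ := Finset.mem_add.1 (support_mul _ _ hb)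
    rw [Finset.HasAntidiagonal.mem_antidiagonal] at hm
    obtain rfl : m₁ + m₂ = m := hm
    have e : ((b₁ + b₂, m₁ + m₂) : (Fin n →₀ ℕ) × ℕ) = (b₁, m₁) + (b₂, m₂) := rfl
    rw [e, excess_add]
    exact add_pos_of_nonneg_of_pos
      (excess_nonneg_of_mem_pow hJ hu hX m₁ ((mem_reesAlgebra_iff _ _).1 s.2 m₁) b₁ h₁)
      (hp m₂ b₂ h₂)

theorem toPoint_coe_mem (a : Fin r ≃ minGenExponents J) (j : Fin r) :
    toPoint (a j : Fin n →₀ ℕ) ∈ newtonPolyhedron J :=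
  toPoint_mem_newtonPolyhedron (a j).2.1

/-- An element of D has its image in 𝔪R(J), where all terms have positive excess; the truncation to
excess ≤ 0 is therefore zero. -/
theorem fiberIdeal_le_ker_faceMap (hJ : IsMonomialIdeal J) (a : Fin r ≃ minGenExponents J)
    {F : Set (Fin n → ℝ)} (hF : IsPositiveFace (newtonPolyhedron J) F) :
    fiberIdeal J a ≤ RingHom.ker (faceMap K (fun j => (a j : Fin n →₀ ℕ)) F) := by
  obtain ⟨u, c, hu, hX, rfl⟩ := hF
  intro g hg
  rw [mem_fiberIdeal_iff] at hg
  rw [RingHom.mem_ker]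
  ext m b
  have := coeff_faceMap (toPoint_coe_mem a) hX g (b, m)
  rw [this]
  split_ifs with h
  · by_contra hne
    rw [← coe_reesMap] at hne
    exact absurd (excess_pos_of_mem_map hJ hu hX hg m b (mem_support_iff.2 hne)) (not_lt.2 h)
  · simp

theorem radical_fiberIdeal_le (hJ : IsMonomialIdeal J) (a : Fin r ≃ minGenExponents J) :
    (fiberIdeal J a).radical ≤ ⨅ F ∈ maximalCompactFaces (newtonPolyhedron J),
      (idealP K (fun j => (a j : Fin n →₀ ℕ)) F ⊔ idealB K (fun j => (a j : Fin n →₀ ℕ)) F) := by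
  refine le_iInf₂ fun F hF => ?_
  rw [← ker_faceMap]
  exact (RingHom.ker_isPrime _).isRadical.radical_le_iff.2
    (fiberIdeal_le_ker_faceMap hJ a (isPositiveFace_of_mem_maximalCompactFaces hF))

/-- Each multihomogeneous component of g is treated separately. If its degree is that of a monomial
supported on some F, the whole component is supported on F and lies in B_F; otherwise each of its
monomials lies in every P_F. -/
theorem iInf_sup_le (a : Fin r ≃ minGenExponents J) :
    (⨅ F ∈ maximalCompactFaces (newtonPolyhedron J),
      (idealP K (fun j => (a j : Fin n →₀ ℕ)) F ⊔ idealB K (fun j => (a j : Fin n →₀ ℕ)) F)) ≤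
    (⨅ F ∈ maximalCompactFaces (newtonPolyhedron J), idealP K (fun j => (a j : Fin n →₀ ℕ)) F) ⊔
      ⨆ F ∈ maximalCompactFaces (newtonPolyhedron J),
        idealB K (fun j => (a j : Fin n →₀ ℕ)) F := by
  classical
  intro g hg
  rw [← finsum_weightedHomogeneousComponent (fun j => ((a j : Fin n →₀ ℕ), 1)) g]
  refine finsum_induction (· ∈ (_ : Ideal (MvPolynomial (Fin r) K))) (zero_mem _)
    (fun _ _ => add_mem) fun w => ?_
  have hsupp : ∀ α ∈ (weightedHomogeneousComponent (fun j => ((a j : Fin n →₀ ℕ), 1)) w g).support,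
      multidegree (fun j => (a j : Fin n →₀ ℕ)) α = w := by
    intro α hα
    rw [support_weightedHomogeneousComponent, Finset.mem_filter] at hα
    exact hα.2
  by_cases h : ∃ F ∈ maximalCompactFaces (newtonPolyhedron J), ∃ α,
      multidegree (fun j => (a j : Fin n →₀ ℕ)) α = w ∧
      SupportedOn (fun j => (a j : Fin n →₀ ℕ)) F α
  · obtain ⟨F, hF, α, rfl, hα⟩ := h
    refine Ideal.mem_sup_right (Ideal.mem_iSup_of_mem F (Ideal.mem_iSup_of_mem hF ?_))
    apply mem_idealB_of_supportedOn
    · intro β hβ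
      obtain ⟨u, c, hu, hX, rfl⟩ := isPositiveFace_of_mem_maximalCompactFaces hF
      rw [supportedOn_iff_excess_le (toPoint_coe_mem a) hX] at hα ⊢
      rwa [hsupp β hβ]
    · rw [faceMap_weightedHomogeneousComponent]
      have : g ∈ RingHom.ker (faceMap K (fun j => (a j : Fin n →₀ ℕ)) F) := by
        rw [ker_faceMap]
        simp only [Ideal.mem_iInf] at hg
        exact hg F hF
      rw [RingHom.mem_ker.1 this]
      simp
  · refine Ideal.mem_sup_left ?_
    simp only [Ideal.mem_iInf]
    intro F hF
    rw [idealP, mem_ideal_span_X_image]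
    intro α hα
    by_contra! hc
    refine h ⟨F, hF, α, hsupp α hα, fun j hj => ?_⟩
    by_contra hjF
    exact hj (hc j hjF)

theorem monomial_one_mem_pow (a : Fin r → Fin n →₀ ℕ) (ha : ∀ j, a j ∈ exponents J)
    (e : Fin r → ℕ) (b : Fin n →₀ ℕ) (hb : ∑ j, e j • a j ≤ b) :
    monomial b (1 : K) ∈ J ^ (∑ j, e j) := by
  obtain ⟨d, rfl⟩ := exists_add_of_le hb
  rw [← one_mul (1 : K), ← monomial_mul]
  refine Ideal.mul_mem_right _ _ ?_
  rw [monomial_sum_one, ← Finset.prod_pow_eq_pow_sum]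
  refine Ideal.prod_mem_prod fun j _ => ?_
  have := Ideal.pow_mem_pow (ha j) (e j)
  rwa [monomial_pow, one_pow] at this

theorem monomial_mem_radical (a : Fin r ≃ minGenExponents J) {α : Fin r →₀ ℕ}
    (hα : ∀ F, IsPositiveFace (newtonPolyhedron J) F →
      ¬ SupportedOn (fun j => (a j : Fin n →₀ ℕ)) F α) :
    monomial α (1 : K) ∈ (fiberIdeal J a).radical := by
  classical
  set w := multidegree (fun j => (a j : Fin n →₀ ℕ)) α with hw
  -- The first alternative produces a positive face supporting α, which is excluded; the second
  -- shows that y^{Sα} maps into 𝔪R(J).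
  rcases exists_pos_functional_or (fun j k => (a j : Fin n →₀ ℕ) k) w.1 w.2 with
    ⟨u, c, hu, hc, hb⟩ | ⟨i, S, e, hS, he⟩
  · have hX : ∀ v ∈ newtonPolyhedron J, c ≤ v ⬝ᵥ u := by
      refine convexHull_min (t := {v | c ≤ v ⬝ᵥ u}) ?_ ?_
      · rintro _ ⟨b, hb, rfl⟩
        obtain ⟨d, hd, hdb⟩ := exists_minGenExponents_le hb
        obtain ⟨j, hj⟩ := a.surjective ⟨d, hd⟩
        have h1 := hc j
        rw [hj] at h1
        refine h1.trans (Finset.sum_le_sum fun k _ => ?_)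
        exact mul_le_mul_of_nonneg_right (Nat.cast_le.2 (hdb k)) (hu k).le
      · intro v hv v' hv' s t hs ht hst
        simp only [Set.mem_ofPred_eq, add_dotProduct, smul_dotProduct, smul_eq_mul] at hv hv' ⊢
        have e : c = s * c + t * c := by rw [← add_mul, hst, one_mul]
        rw [e]
        gcongr
    refine absurd ?_ (hα _ ⟨u, c, hu, hX, rfl⟩)
    rw [supportedOn_iff_excess_le (toPoint_coe_mem a) hX]
    exact sub_nonpos.2 hb
  · refine ⟨S, ?_⟩
    rw [monomial_pow, one_pow, mem_fiberIdeal_iff]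
    -- Here x^{Sb} = x_i x^d, and x^d is divisible by a product of S m generators, so x^d t^{Sm}
    -- lies in the Rees algebra.
    obtain ⟨d, hd, hde⟩ : ∃ d, S • w.1 = d + Finsupp.single i 1 ∧
        ∑ j, e j • (a j : Fin n →₀ ℕ) ≤ d := by
      have h1 : Finsupp.single i 1 ≤ S • w.1 := by
        rw [Finsupp.single_le_iff]
        have := he i
        simp only [if_true] at this
        simp only [Finsupp.smul_apply, smul_eq_mul]
        omega
      refine ⟨S • w.1 - Finsupp.single i 1, (tsub_add_cancel_of_le h1).symm, fun k => ?_⟩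
      have := he k
      simp only [Finsupp.coe_tsub, Pi.sub_apply, Finsupp.smul_apply, smul_eq_mul,
        Finsupp.single_apply, Finsupp.coe_finsetSum, Finset.sum_apply, eq_comm (a := i)] at this ⊢
      omega
    have hmem : Polynomial.monomial (S * w.2) (monomial d (1 : K)) ∈ reesAlgebra J := by
      rw [reesAlgebra.monomial_mem, hS]
      exact monomial_one_mem_pow _ (fun j => (a j).2.1) e d hde
    have : reesMap J a (monomial (S • α) 1) =
        ⟨_, hmem⟩ * algebraMap (MvPolynomial (Fin n) K) (reesAlgebra J) (X i) := by
      apply Subtype.ext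
      rw [coe_reesMap, faceMap_monomial_of_supportedOn (fun _ _ => Set.mem_univ _), map_nsmul,
        ← hw, Prod.smul_fst, Prod.smul_snd, hd, Subalgebra.coe_mul, smul_eq_mul]
      change _ = Polynomial.monomial (S * w.2) (monomial d (1 : K)) * Polynomial.C (X i)
      rw [Polynomial.monomial_mul_C, X, monomial_mul, one_mul]
    rw [this]
    exact Ideal.mul_mem_left _ _ (Ideal.mem_map_of_mem _ (Ideal.subset_span ⟨i, rfl⟩))

/-- Each P_F is a monomial ideal, so the claim reduces to the monomials of g. None is supported on a
positive face, since that face would lie in a maximal compact one. -/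
theorem iInf_idealP_le_radical (a : Fin r ≃ minGenExponents J) :
    (⨅ F ∈ maximalCompactFaces (newtonPolyhedron J),
      idealP K (fun j => (a j : Fin n →₀ ℕ)) F) ≤ (fiberIdeal J a).radical := by
  intro g hg
  simp only [Ideal.mem_iInf] at hg
  rw [g.as_sum]
  refine sum_mem fun α hα => ?_
  rw [← mul_one (coeff α g), ← C_mul_monomial]
  refine Ideal.mul_mem_left _ _ (monomial_mem_radical a fun F hF hs => ?_)
  obtain ⟨G, hG, hFG⟩ := exists_maximalCompactFaces_ge a hF
  obtain ⟨j, hj, hne⟩ := mem_ideal_span_X_image.1 (hg G hG) α hα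
  exact hj (hFG (hs j hne))

end Rees

end ExtremalIdeal

theorem proposition4p3 {K : Type*} [Field K] {n r : ℕ}
    (J : Ideal (MvPolynomial (Fin n) K)) (hJ : ExtremalIdeal.IsExtremal J)
    (a : Fin r ≃ ExtremalIdeal.minGenExponents J) :
    (ExtremalIdeal.fiberIdeal J a).radical =
        (⨅ F ∈ ExtremalIdeal.maximalCompactFaces (ExtremalIdeal.newtonPolyhedron J),
            ExtremalIdeal.idealP K (fun j => (a j : Fin n →₀ ℕ)) F) ⊔
          (⨆ F ∈ ExtremalIdeal.maximalCompactFaces (ExtremalIdeal.newtonPolyhedron J),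
            ExtremalIdeal.idealB K (fun j => (a j : Fin n →₀ ℕ)) F) ∧
      (ExtremalIdeal.fiberIdeal J a).radical =
        ⨅ F ∈ ExtremalIdeal.maximalCompactFaces (ExtremalIdeal.newtonPolyhedron J),
          (ExtremalIdeal.idealP K (fun j => (a j : Fin n →₀ ℕ)) F ⊔
            ExtremalIdeal.idealB K (fun j => (a j : Fin n →₀ ℕ)) F) := by
  have h₁ := ExtremalIdeal.radical_fiberIdeal_le hJ.1 a
  have h₂ := ExtremalIdeal.iInf_sup_le a
  have h₃ := sup_le (ExtremalIdeal.iInf_idealP_le_radical a) (iSup₂_le fun F _ =>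
    (ExtremalIdeal.idealB_le_fiberIdeal a F).trans Ideal.le_radical :
      (⨆ F ∈ ExtremalIdeal.maximalCompactFaces (ExtremalIdeal.newtonPolyhedron J),
        ExtremalIdeal.idealB K (fun j => (a j : Fin n →₀ ℕ)) F) ≤ _)
  exact ⟨(h₁.trans h₂).antisymm h₃, h₁.antisymm (h₂.trans h₃)⟩
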